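/- Let $H$ be a real Hilbert space, let $A,B:H\to 2^H$ be maximally monotone, and let $C:H\to H$ be $\beta$-cocoercive for some $\beta>0$, i.e. $\langle x-y,Cx-Cy\rangle\ge\beta\|Cx-Cy\|^2$ for all $x,y\in H$. Assume that $\operatorname{zer}(A+B+C)=\{x\in H: 0\in Ax+Bx+Cx\}$ is nonempty and let $\gamma\in(0,2\beta)$. Write $J_{\gamma A}=(I+\gamma A)^{-1}$, $J_{\gamma B}=(I+\gamma B)^{-1}$ for the resolvents and put $$T=I-J_{\gamma B}+J_{\gamma A}\circ(2J_{\gamma B}-I-\gamma\, C J_{\gamma B}).$$ For arbitrary $z^0,z^{-1}\in H$ let the sequences be generated, for $k=0,1,2,\dots$, by $$y^k=z^k+\alpha_k(z^k-z^{k-1}),\quad x_B^k=J_{\gamma B}y^k,\quad x_A^k=J_{\gamma A}(2x_B^k-y^k-\gamma Cx_B^k),\quad z^{k+1}=y^k+\lambda_k(x_A^k-x_B^k).$$ Assume that $0\le\alpha_k\le\alpha<1$ and $0<\underline\lambda\le\lambda_k<1$ for all $k\ge 0$ (with constants $\alpha$, $\underline\lambda$), and that $\sum_{k=0}^{\infty}\alpha_k\|z^k-z^{k-1}\|^2<+\infty$.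 Then: (i) $\{z^k\}$ converges weakly to a fixed point $z^*$ of $T$. With this $z^*$, moreover: (ii) $\{x_B^k\}$ converges weakly to $J_{\gamma B}z^*\in\operatorname{zer}(A+B+C)$. (iii) $\{x_A^k\}$ converges weakly to $J_{\gamma B}z^*\in\operatorname{zer}(A+B+C)$. (iv) $\{x_A^k\}$ and $\{x_B^k\}$ converge strongly to $J_{\gamma B}z^*\in\operatorname{zer}(A+B+C)$ if one of the following holds: (a) $A$ is uniformly monotone on every nonempty bounded subset of $\operatorname{dom}A$; (b) $B$ is uniformly monotone on every nonempty bounded subset of $\operatorname{dom}B$; (c) $C$ is demiregular at every point of $\operatorname{zer}(A+B+C)$. Here an operator $M:H\to 2^H$ is uniformly monotone on a set $S\subseteq\operatorname{dom}M$ if there is an increasing (i.e. nondecreasing) function $\varphi:[0,+\infty)\to[0,+\infty]$ that vanishes only at $0$ such that $\langle x-y,u-v\rangle\ge\varphi(\|x-y\|)$ for all $x,y\in S$, $u\in Mx$, $v\in My$; and $C$ is demiregular at $x$ if for every sequence with $x^k\rightharpoonup x$ and $Cx^k\to Cx$ one has $x^k\to x$. -/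

import Mathlib

open Filter Topology
open scoped Pointwise NNReal ENNReal

namespace MonotoneInclusion

variable {H : Type*} [NormedAddCommGroup H] [InnerProductSpace ℝ H]

/-- The graph `{(x, u) | u ∈ A x}` of a set-valued operator. -/
def gra (A : H → Set H) : Set (H × H) := {p | p.2 ∈ A p.1}

/-- The domain of a set-valued operator. -/
def dom (A : H → Set H) : Set H := {x | (A x).Nonempty}

/-- The zeros of a set-valued operator. -/
def zer (A : H → Set H) : Set H := {x | 0 ∈ A x}

/-- The inverse of a set-valued operator. -/
def inverse (A : H → Set H) : H → Set H := fun u => {x | u ∈ A x}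

/-- A single-valued operator, regarded as a set-valued one. -/
def single (C : H → H) : H → Set H := fun x => {C x}

/-- Monotonicity of a set-valued operator. -/
def IsMonotone (A : H → Set H) : Prop :=
  ∀ x u y v, (x, u) ∈ gra A → (y, v) ∈ gra A → 0 ≤ inner ℝ (x - y) (u - v)

/-- Maximal monotonicity: the graph is not strictly contained in the graph of another
monotone operator. -/
def IsMaximallyMonotone (A : H → Set H) : Prop :=
  IsMonotone A ∧ ∀ A' : H → Set H, IsMonotone A' → ¬ gra A ⊂ gra A'

/-- `A` is uniformly monotone on the set `S`: there is an increasing modulus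
`φ : [0, ∞) → [0, ∞]`, vanishing only at `0`, with
`⟪x - y, u - v⟫ ≥ φ ‖x - y‖` for all `(x, u), (y, v) ∈ gra A` with `x, y ∈ S`. -/
def IsUniformlyMonotoneOn (A : H → Set H) (S : Set H) : Prop :=
  ∃ φ : ℝ≥0 → ℝ≥0∞, Monotone φ ∧ (∀ t, φ t = 0 ↔ t = 0) ∧
    ∀ x ∈ S, ∀ y ∈ S, ∀ u v, (x, u) ∈ gra A → (y, v) ∈ gra A →
      ((φ ‖x - y‖₊ : ℝ≥0∞) : EReal) ≤ ((inner ℝ (x - y) (u - v) : ℝ) : EReal)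

/-- `A` is uniformly monotone on every nonempty bounded subset of its domain. -/
def IsUniformlyMonotoneOnBounded (A : H → Set H) : Prop :=
  ∀ S : Set H, S ⊆ dom A → S.Nonempty → Bornology.IsBounded S → IsUniformlyMonotoneOn A S

/-- Weak convergence of a sequence. -/
def WeakTendsto (x : ℕ → H) (a : H) : Prop :=
  Tendsto (fun k => toWeakSpace ℝ H (x k)) atTop (𝓝 (toWeakSpace ℝ H a))

/-- Demiregularity of a set-valued operator at a point of its domain. -/
def IsDemiregularAt (A : H → Set H) (x : H) : Prop :=
  x ∈ dom A ∧ ∀ u ∈ A x, ∀ xs us : ℕ → H, (∀ k, (xs k, us k) ∈ gra A) →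
    WeakTendsto xs x → Tendsto us atTop (𝓝 u) → Tendsto xs atTop (𝓝 x)

/-- `β`-cocoercivity of a single-valued operator. -/
def IsCocoercive (β : ℝ) (C : H → H) : Prop :=
  ∀ x y, β * ‖C x - C y‖ ^ 2 ≤ inner ℝ (x - y) (C x - C y)

/-- The set-valued operator `(I + γ A)⁻¹`. -/
def resolventRel (γ : ℝ) (A : H → Set H) : H → Set H :=
  inverse (fun x => {x} + γ • A x)

/-- The resolvent `J_{γA} = (I + γ A)⁻¹` as a map `H → H`: its value at `y` is an element of
`(I + γ A)⁻¹ y`. For `A` maximally monotone and `γ > 0` there is exactly one such element. -/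
noncomputable def resolventMap (γ : ℝ) (A : H → Set H) : H → H :=
  fun y => Classical.epsilon fun x => x ∈ resolventRel γ A y

/-- The operator `T = I - J_{γB} + J_{γA} ∘ (2 J_{γB} - I - γ C J_{γB})`. -/
noncomputable def splittingMap (γ : ℝ) (A B : H → Set H) (C : H → H) : H → H := fun x =>
  x - resolventMap γ B x +
    resolventMap γ A ((2 : ℝ) • resolventMap γ B x - x - γ • C (resolventMap γ B x))

/-- The sequences `z, y, x_A, x_B` are generated by the inertial three-operator splitting
algorithm. The sequence `z` is indexed from `-1` on: `z (-1)` and `z 0` are the arbitrary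
starting points, and the values of `z` below `-1` play no role. -/
structure IsInertialSplitting (γ : ℝ) (A B : H → Set H) (C : H → H) (α lam : ℕ → ℝ)
    (z : ℤ → H) (y xA xB : ℕ → H) : Prop where
  y_eq : ∀ k : ℕ, y k = z k + α k • (z k - z ((k : ℤ) - 1))
  xB_eq : ∀ k : ℕ, xB k = resolventMap γ B (y k)
  xA_eq : ∀ k : ℕ, xA k = resolventMap γ A ((2 : ℝ) • xB k - y k - γ • C (xB k))
  z_eq : ∀ k : ℕ, z ((k : ℤ) + 1) = y k + lam k • (xA k - xB k)

end MonotoneInclusion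

open MonotoneInclusion

/-!
Throughout, let `x = J_{γB} p` for a fixed point `p` of the splitting operator `T`.

*Descent.* Adding the monotonicity inequalities of `A` and `B` between the iterates and `x` gives
(`norm_sq_add_smul_le`)
`‖z⁺ - p‖² ≤ ‖y - p‖² - λ (‖d + γ c‖² + γ (2β - γ) ‖c‖² + 2 γ m_B + 2 γ m_A)`
with `d = x_A - x_B`, `c = C x_B - C x` and `m_A, m_B ≥ 0` the two monotonicity terms. Together with
the extrapolation identity for `‖y - p‖²` this is a second order recursion for `‖z^k - p‖²`, and
`inertial_recursion` shows that these distances converge and the subtracted terms are summable.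
Hence `x_A - x_B → 0`, `C x_B → C x` strongly, and `m_A, m_B → 0` (`IsInertialSplitting.fejer`).

*Weak convergence.* The selections of `A` at `x_A` and of `B` at `x_B` have a strongly convergent
sum, so their graphs are jointly closed along the iteration (`mem_and_mem_of_weakTendstoAlong`). As
a result every weak cluster point `w` of `z` is a fixed point, and `x_B` converges weakly to
`J_{γB} w` along with it (`cluster_isFixedPt`); no weak continuity of the resolvent is needed.
Opial's lemma (`opial`) leaves only one cluster point. Cluster points are taken along ultrafilters
rather than subsequences, so that Banach–Alaoglu applies in a space that need not be separable.

*Strong convergence.* Uniform monotonicity bounds a modulus of `‖x_A - x‖` or `‖x_B - x‖` by the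
vanishing `m_A` or `m_B`; demiregularity applies directly to `x_B ⇀ x` and `C x_B → C x`.

That the resolvents are defined everywhere is Minty's theorem
(`IsMaximallyMonotone.resolvent_mem`), proved by minimizing a quadratically perturbed Fitzpatrick
function.
-/

namespace MonotoneInclusion

/-! ### Minty's theorem and the resolvent -/

/-- A closed convex set of pairs `(x, t)` on which `t + ‖x‖² / 2` is nonnegative contains a
minimizer of this function; the last term on the left is the gain from strong convexity.
Minimizing sequences are Cauchy by the parallelogram law, so no compactness is used. -/
theorem exists_minimizer_add_half_sq {K : Type*} [NormedAddCommGroup K] [InnerProductSpace ℝ K]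
    [CompleteSpace K] {E : Set (K × ℝ)} (hcl : IsClosed E) (hconv : Convex ℝ E)
    (hne : E.Nonempty) (hb : ∀ p ∈ E, 0 ≤ p.2 + ‖p.1‖ ^ 2 / 2) :
    ∃ p₀ ∈ E, ∀ p ∈ E,
      p₀.2 + ‖p₀.1‖ ^ 2 / 2 + ‖p.1 - p₀.1‖ ^ 2 / 2 ≤ p.2 + ‖p.1‖ ^ 2 / 2 := by
  set g : K × ℝ → ℝ := fun p => p.2 + ‖p.1‖ ^ 2 / 2 with hg
  have hbdd : BddBelow (g '' E) := ⟨0, by rintro _ ⟨p, hp, rfl⟩; exact hb p hp⟩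
  set m := sInf (g '' E) with hm
  have hmle : ∀ p ∈ E, m ≤ g p := fun p hp => csInf_le hbdd ⟨p, hp, rfl⟩
  have hseg : ∀ p ∈ E, ∀ q ∈ E, ∀ s : ℝ, 0 ≤ s → s ≤ 1 →
      m ≤ (1 - s) * g p + s * g q - s * (1 - s) / 2 * ‖q.1 - p.1‖ ^ 2 := by
    intro p hp q hq s h0 h1
    have h := hmle _ (hconv hp hq (sub_nonneg.2 h1) h0 (by ring))
    refine h.trans (le_of_eq ?_)
    simp only [hg, Prod.fst_add, Prod.smul_fst, Prod.snd_add, Prod.smul_snd, smul_eq_mul]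
    rw [norm_add_sq_real, norm_sub_sq_real, norm_smul, norm_smul, mul_pow, mul_pow,
      Real.norm_eq_abs, Real.norm_eq_abs, sq_abs, sq_abs, real_inner_smul_left,
      real_inner_smul_right, real_inner_comm p.1 q.1]
    ring
  have hex : ∀ n : ℕ, ∃ p ∈ E, g p < m + 1 / ((n : ℝ) + 1) := by
    intro n
    obtain ⟨_, ⟨p, hp, rfl⟩, h⟩ := exists_lt_of_csInf_lt (hne.image g)
      (show sInf (g '' E) < m + 1 / ((n : ℝ) + 1) by
        have : 0 < 1 / ((n : ℝ) + 1) := by positivity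
        linarith)
    exact ⟨p, hp, h⟩
  choose p hpE hpg using hex
  have hε : Tendsto (fun n : ℕ => 1 / ((n : ℝ) + 1)) atTop (𝓝 0) :=
    tendsto_one_div_add_atTop_nhds_zero_nat
  have hcau : CauchySeq fun n => (p n).1 := by
    refine cauchySeq_of_le_tendsto_0 (fun n : ℕ => √(8 * (1 / ((n : ℝ) + 1)))) ?_ ?_
    · intro i j N hi hj
      rw [dist_eq_norm]
      apply Real.le_sqrt_of_sq_le
      have h := hseg _ (hpE j) _ (hpE i) (1 / 2) (by norm_num) (by norm_num)
      have h1 := hpg i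
      have h2 := hpg j
      have h3 : 1 / ((i : ℝ) + 1) ≤ 1 / ((N : ℝ) + 1) := by gcongr
      have h4 : 1 / ((j : ℝ) + 1) ≤ 1 / ((N : ℝ) + 1) := by gcongr
      linarith
    · simpa using (hε.const_mul 8).sqrt
  obtain ⟨x₀, hx₀⟩ := cauchySeq_tendsto_of_complete hcau
  have hgm : Tendsto (fun n => g (p n)) atTop (𝓝 m) := by
    refine tendsto_of_tendsto_of_tendsto_of_le_of_le tendsto_const_nhds
      (by simpa using hε.const_add m) (fun n => hmle _ (hpE n)) fun n => (hpg n).le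
  have ht : Tendsto (fun n => (p n).2) atTop (𝓝 (m - ‖x₀‖ ^ 2 / 2)) :=
    (hgm.sub ((hx₀.norm.pow 2).div_const 2)).congr fun n => by simp [hg]
  refine ⟨(x₀, m - ‖x₀‖ ^ 2 / 2),
    hcl.mem_of_tendsto (hx₀.prodMk_nhds ht) (Eventually.of_forall hpE), fun q hq => ?_⟩
  have hE₀ := hcl.mem_of_tendsto (hx₀.prodMk_nhds ht) (Eventually.of_forall hpE)
  have h0 := hmle q hq
  by_contra! hcon
  set D := ‖q.1 - x₀‖ ^ 2 with hD
  set r := g q - m with hr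
  have hlt : r < D / 2 := by
    simp only [hr, hg]
    simp only [hD]
    linarith
  have hr0 : 0 ≤ r := sub_nonneg.2 h0
  have hDpos : 0 < D := by linarith
  -- a step of this length from the minimizer towards `q` would go below the infimum
  have hs := hseg _ hE₀ q hq ((D / 2 - r) / D) (by apply div_nonneg <;> linarith)
    (by rw [div_le_one hDpos]; linarith)
  have e0 : g (x₀, m - ‖x₀‖ ^ 2 / 2) = m := by simp [hg]
  rw [e0] at hs
  change m ≤ _ - _ * D at hs
  set s := (D / 2 - r) / D with hs'
  have hspos : 0 < s := div_pos (by linarith) hDpos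
  have hsD : s * D = D / 2 - r := by rw [hs']; field_simp
  have h2 : 0 ≤ s * (r - (1 - s) / 2 * D) := by
    have : g q = r + m := by simp [hr]
    rw [this] at hs
    linarith
  have h3 := nonneg_of_mul_nonneg_right h2 hspos
  linarith

variable {H : Type*} [NormedAddCommGroup H] [InnerProductSpace ℝ H]

/-- Surjectivity in Minty's theorem, for a maximal monotone subset `G` of `H × H`: the range of
`I + G` contains `0`. With `F` the Fitzpatrick function of `G`, i.e. the supremum of
`⟪x, v⟫ + ⟪y, u⟫ - ⟪y, v⟫` over `(y, v) ∈ G`, the function `F (x, u) + (‖x‖² + ‖u‖²) / 2` has a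
minimizer `(x₀, u₀)`; strong convexity, `F ≥ ⟪·, ·⟫` and `F = ⟪·, ·⟫` on `G` give
`⟪y + u₀, v + x₀⟫ ≥ ‖x₀ + u₀‖²` on `G`, and maximality puts `(-u₀, -x₀)` into `G`. -/
theorem exists_neg_mem_of_maximal [CompleteSpace H] {G : Set (H × H)} (hne : G.Nonempty)
    (hmon : ∀ p ∈ G, ∀ q ∈ G, 0 ≤ inner ℝ (p.1 - q.1) (p.2 - q.2))
    (hmax : ∀ x u, (∀ q ∈ G, 0 ≤ inner ℝ (x - q.1) (u - q.2)) → (x, u) ∈ G) :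
    ∃ x, (x, -x) ∈ G := by
  let E : Set (WithLp 2 (H × H) × ℝ) :=
    {P | ∀ q ∈ G, inner ℝ P.1.fst q.2 + inner ℝ q.1 P.1.snd - inner ℝ q.1 q.2 ≤ P.2}
  have hE : ∀ P ∈ E, inner ℝ P.1.fst P.1.snd ≤ P.2 := by
    intro P hP
    by_cases hPG : (P.1.fst, P.1.snd) ∈ G
    · have := hP _ hPG
      simpa using this
    · have : ¬ ∀ q ∈ G, 0 ≤ inner ℝ (P.1.fst - q.1) (P.1.snd - q.2) :=
        fun h => hPG (hmax _ _ h)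
      push Not at this
      obtain ⟨q, hq, hlt⟩ := this
      have h2 := hP q hq
      rw [inner_sub_left, inner_sub_right, inner_sub_right] at hlt
      linarith
  have hcl : IsClosed E := by
    have : E = ⋂ q ∈ G, {P : WithLp 2 (H × H) × ℝ |
        inner ℝ P.1.fst q.2 + inner ℝ q.1 P.1.snd - inner ℝ q.1 q.2 ≤ P.2} := by
      ext P; simp [E]
    rw [this]
    refine isClosed_biInter fun q _ => isClosed_le ?_ continuous_snd
    have h1 : Continuous fun P : WithLp 2 (H × H) × ℝ => P.1.fst :=
      (WithLp.prod_continuous_ofLp 2 H H).fst.comp continuous_fst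
    have h2 : Continuous fun P : WithLp 2 (H × H) × ℝ => P.1.snd :=
      (WithLp.prod_continuous_ofLp 2 H H).snd.comp continuous_fst
    fun_prop
  have hconv : Convex ℝ E := by
    intro P hP Q hQ a b ha hb hab q hq
    have h1 := mul_le_mul_of_nonneg_left (hP q hq) ha
    have h2 := mul_le_mul_of_nonneg_left (hQ q hq) hb
    have h3 : inner ℝ q.1 q.2 = a * inner ℝ q.1 q.2 + b * inner ℝ q.1 q.2 := by
      rw [← add_mul, hab, one_mul]
    simp only [Prod.fst_add, Prod.smul_fst, Prod.snd_add, Prod.smul_snd, smul_eq_mul,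
      WithLp.add_fst, WithLp.smul_fst, WithLp.add_snd, WithLp.smul_snd, inner_add_left,
      inner_add_right, real_inner_smul_left, real_inner_smul_right]
    linarith
  have hmem : ∀ q ∈ G, (WithLp.toLp 2 q, inner ℝ q.1 q.2) ∈ E := by
    intro q hq q' hq'
    have := hmon q hq q' hq'
    rw [inner_sub_left, inner_sub_right, inner_sub_right] at this
    change inner ℝ q.1 q'.2 + inner ℝ q'.1 q.2 - inner ℝ q'.1 q'.2 ≤ inner ℝ q.1 q.2
    linarith
  obtain ⟨P₀, hP₀, hmin⟩ := exists_minimizer_add_half_sq hcl hconv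
    (hne.elim fun q hq => ⟨_, hmem q hq⟩) (by
      intro P hP
      have h := hE P hP
      have h2 := norm_add_sq_real P.1.fst P.1.snd
      rw [WithLp.prod_norm_sq_eq_of_L2]
      nlinarith [sq_nonneg ‖P.1.fst + P.1.snd‖])
  set x₀ := P₀.1.fst with hx₀
  set u₀ := P₀.1.snd with hu₀
  have key : ∀ q ∈ G, ‖x₀ + u₀‖ ^ 2 ≤ inner ℝ (-u₀ - q.1) (-x₀ - q.2) := by
    intro q hq
    have h1 := hmin _ (hmem q hq)
    have h2 := hE P₀ hP₀
    simp only [WithLp.prod_norm_sq_eq_of_L2, WithLp.sub_fst, WithLp.sub_snd] at h1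
    rw [← hx₀, ← hu₀] at h1 h2
    rw [norm_sub_sq_real, norm_sub_sq_real] at h1
    change _ + (‖q.1‖ ^ 2 - 2 * inner ℝ q.1 x₀ + _ + (‖q.2‖ ^ 2 - 2 * inner ℝ q.2 u₀ + _)) / 2 ≤
      _ + (‖q.1‖ ^ 2 + ‖q.2‖ ^ 2) / 2 at h1
    rw [norm_add_sq_real, inner_sub_left, inner_sub_right, inner_sub_right, inner_neg_neg,
      inner_neg_left, inner_neg_right, real_inner_comm x₀ u₀, real_inner_comm q.2 u₀]
    linarith
  have hG : (-u₀, -x₀) ∈ G := hmax _ _ fun q hq => (sq_nonneg _).trans (key q hq)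
  have h0 := key _ hG
  simp only [sub_self, inner_zero_left] at h0
  have h1 : x₀ + u₀ = 0 := by
    have := pow_eq_zero_iff (two_ne_zero) |>.1 (le_antisymm h0 (sq_nonneg _))
    simpa using this
  rw [eq_neg_of_add_eq_zero_right h1, neg_neg] at hG
  exact ⟨x₀, hG⟩

/-- A point monotonically related to a maximally monotone operator lies in its graph. -/
theorem IsMaximallyMonotone.mem {A : H → Set H} (hA : IsMaximallyMonotone A) {x u : H}
    (h : ∀ y v, v ∈ A y → 0 ≤ inner ℝ (x - y) (u - v)) : u ∈ A x := by
  by_contra hxu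
  refine hA.2 (fun y => A y ∪ {v | y = x ∧ v = u}) ?_ ?_
  · rintro y v y' v' (hv | ⟨rfl, rfl⟩) (hv' | ⟨rfl, rfl⟩)
    · exact hA.1 _ _ _ _ hv hv'
    · have := h y v hv
      rwa [← neg_sub, ← neg_sub v, inner_neg_neg] at this
    · exact h _ _ hv'
    · simp
  · refine ⟨fun p hp => Or.inl hp, fun hsub => hxu ?_⟩
    exact hsub (show (x, u) ∈ _ from Or.inr ⟨rfl, rfl⟩)

theorem mem_resolventRel_iff {γ : ℝ} (hγ : γ ≠ 0) {A : H → Set H} {x y : H} :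
    x ∈ resolventRel γ A y ↔ γ⁻¹ • (y - x) ∈ A x := by
  simp only [resolventRel, inverse, Set.mem_ofPred_eq, Set.singleton_add, Set.mem_image]
  constructor
  · rintro ⟨_, ⟨a, ha, rfl⟩, rfl⟩
    simpa [smul_smul, inv_mul_cancel₀ hγ] using ha
  · intro h
    exact ⟨y - x, ⟨_, h, by simp [smul_smul, mul_inv_cancel₀ hγ]⟩, by simp⟩

/-- Monotonicity of `A` in terms of the resolvent equation `u = (y - x) / γ`. -/
theorem IsMonotone.inner_resolvent_nonneg {A : H → Set H} (hA : IsMonotone A) {γ : ℝ}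
    (hγ : 0 < γ) {x y x' y' : H} (h : γ⁻¹ • (y - x) ∈ A x) (h' : γ⁻¹ • (y' - x') ∈ A x') :
    0 ≤ inner ℝ (x - x') ((y - x) - (y' - x')) := by
  have h1 := hA _ _ _ _ h h'
  rw [← smul_sub, real_inner_smul_right] at h1
  exact nonneg_of_mul_nonneg_right h1 (inv_pos.2 hγ)

/-- Minty's theorem: for maximally monotone `A` the resolvent has full domain. -/
theorem IsMaximallyMonotone.resolvent_mem [CompleteSpace H] {A : H → Set H}
    (hA : IsMaximallyMonotone A) {γ : ℝ} (hγ : 0 < γ) (y : H) :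
    γ⁻¹ • (y - resolventMap γ A y) ∈ A (resolventMap γ A y) := by
  rw [← mem_resolventRel_iff hγ.ne']
  refine Classical.epsilon_spec (p := fun x => x ∈ resolventRel γ A y) ?_
  -- `A`, scaled by `γ` and translated so that the equation to solve becomes `0 ∈ x + G x`
  let G : Set (H × H) := {p | γ⁻¹ • (y + p.2) ∈ A p.1}
  have hshift : ∀ v, γ⁻¹ • (y + (γ • v - y)) = v := fun v => by
    rw [add_sub_cancel, inv_smul_smul₀ hγ.ne']
  have hG : ∀ x v, v ∈ A x → (x, γ • v - y) ∈ G := fun x v hv => by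
    change γ⁻¹ • (y + (γ • v - y)) ∈ A x
    rwa [hshift]
  obtain ⟨x, hx⟩ := exists_neg_mem_of_maximal (G := G)
    (by
      by_contra hemp
      have hno : ∀ x v, v ∉ A x := fun x v hv => hemp ⟨_, hG x v hv⟩
      exact hno 0 0 (hA.mem fun y v hv => absurd hv (hno y v)))
    (by
      intro p hp q hq
      have h := hA.1 p.1 (γ⁻¹ • (y + p.2)) q.1 (γ⁻¹ • (y + q.2)) hp hq
      rw [← smul_sub, add_sub_add_left_eq_sub, real_inner_smul_right] at h
      exact nonneg_of_mul_nonneg_right h (inv_pos.2 hγ))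
    (by
      intro x u h
      refine hA.mem fun z v hv => ?_
      have h1 := h _ (hG z v hv)
      have h2 : γ⁻¹ • (y + u) - v = γ⁻¹ • (u - (γ • v - y)) := by
        nth_rw 1 [← hshift v]
        rw [← smul_sub, add_sub_add_left_eq_sub]
      rw [h2, real_inner_smul_right]
      exact mul_nonneg (inv_pos.2 hγ).le h1)
  refine ⟨x, (mem_resolventRel_iff hγ.ne').2 ?_⟩
  rw [sub_eq_add_neg]
  exact hx

/-- Uniqueness of the resolvent value. -/
theorem IsMaximallyMonotone.resolvent_eq [CompleteSpace H] {A : H → Set H}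
    (hA : IsMaximallyMonotone A) {γ : ℝ} (hγ : 0 < γ) {x y : H} (h : γ⁻¹ • (y - x) ∈ A x) :
    resolventMap γ A y = x := by
  have h1 := hA.1.inner_resolvent_nonneg hγ (hA.resolvent_mem hγ y) h
  rw [sub_sub_sub_cancel_left, ← neg_sub (resolventMap γ A y) x, inner_neg_right,
    real_inner_self_eq_norm_sq] at h1
  rw [← sub_eq_zero, ← norm_eq_zero]
  nlinarith [norm_nonneg (resolventMap γ A y - x)]

/-! ### Weak convergence along filters -/

section Weak

variable {H : Type*} [NormedAddCommGroup H] [InnerProductSpace ℝ H] {ι : Type*} {l : Filter ι}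

/-- Weak convergence along an arbitrary filter, tested with inner products. -/
def WeakTendstoAlong (l : Filter ι) (x : ι → H) (a : H) : Prop :=
  ∀ v, Tendsto (fun k => inner ℝ (x k) v) l (𝓝 (inner ℝ a v))

theorem weakTendsto_iff [CompleteSpace H] {x : ℕ → H} {a : H} :
    WeakTendsto x a ↔ WeakTendstoAlong atTop x a := by
  have hinj : Function.Injective (topDualPairing ℝ H).flip := by
    intro y z h
    refine ext_inner_left ℝ fun v => ?_
    exact congrArg (fun φ => φ (InnerProductSpace.toDual ℝ H v)) h
  refine (WeakBilin.tendsto_iff_forall_eval_tendsto _ hinj).trans ⟨fun h v => ?_, fun h f => ?_⟩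
  · simp only [real_inner_comm v]
    exact h (InnerProductSpace.toDual ℝ H v)
  · obtain ⟨v, rfl⟩ := (InnerProductSpace.toDual ℝ H).surjective f
    have := h v
    simp only [real_inner_comm v] at this
    exact this

theorem WeakTendstoAlong.add {x y : ι → H} {a b : H} (hx : WeakTendstoAlong l x a)
    (hy : WeakTendstoAlong l y b) : WeakTendstoAlong l (fun k => x k + y k) (a + b) := fun v => by
  simpa only [inner_add_left] using (hx v).add (hy v)

theorem WeakTendstoAlong.sub {x y : ι → H} {a b : H} (hx : WeakTendstoAlong l x a)
    (hy : WeakTendstoAlong l y b) : WeakTendstoAlong l (fun k => x k - y k) (a - b) := fun v => by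
  simpa only [inner_sub_left] using (hx v).sub (hy v)

theorem WeakTendstoAlong.const_smul {x : ι → H} {a : H} (hx : WeakTendstoAlong l x a) (r : ℝ) :
    WeakTendstoAlong l (fun k => r • x k) (r • a) := fun v => by
  simpa only [real_inner_smul_left] using (hx v).const_mul r

theorem weakTendstoAlong_of_tendsto {x : ι → H} {a : H} (hx : Tendsto x l (𝓝 a)) :
    WeakTendstoAlong l x a := fun _ => hx.inner tendsto_const_nhds

theorem tendsto_inner_zero_of_bounded {x y : ι → H} {M : ℝ} (hx : Tendsto x l (𝓝 0))
    (hy : ∀ k, ‖y k‖ ≤ M) : Tendsto (fun k => inner ℝ (x k) (y k)) l (𝓝 0) := by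
  refine squeeze_zero_norm (fun k => (norm_inner_le_norm (𝕜 := ℝ) _ _).trans
    (mul_le_mul_of_nonneg_left (hy k) (norm_nonneg _))) ?_
  simpa using hx.norm.mul_const M

/-- The inner product of a bounded weakly convergent and a strongly convergent family converges. -/
theorem WeakTendstoAlong.tendsto_inner {x y : ι → H} {a b : H} {M : ℝ}
    (hx : WeakTendstoAlong l x a) (hM : ∀ k, ‖x k‖ ≤ M) (hy : Tendsto y l (𝓝 b)) :
    Tendsto (fun k => inner ℝ (x k) (y k)) l (𝓝 (inner ℝ a b)) := by
  have h0 : Tendsto (fun k => y k - b) l (𝓝 0) := by simpa using hy.sub_const b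
  have h1 := (tendsto_inner_zero_of_bounded h0 hM).add (hx b)
  rw [zero_add] at h1
  refine h1.congr fun k => ?_
  rw [real_inner_comm, inner_sub_right, sub_add_cancel]

/-- Bounded families converge weakly along ultrafilters (Banach–Alaoglu). -/
theorem exists_weakTendstoAlong [CompleteSpace H] (U : Ultrafilter ι) {x : ι → H} {M : ℝ}
    (hM : ∀ k, ‖x k‖ ≤ M) : ∃ a, WeakTendstoAlong (U : Filter ι) x a := by
  let f : ι → WeakDual ℝ H := fun k => StrongDual.toWeakDual (InnerProductSpace.toDual ℝ H (x k))
  have hc := WeakDual.isCompact_closedBall (𝕜 := ℝ) (E := H) 0 M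
  obtain ⟨φ, -, hφ⟩ := hc.ultrafilter_le_nhds (U.map f) (by
    rw [le_principal_iff]
    refine Filter.mem_map.2 (Eventually.of_forall fun k => ?_)
    simpa [f] using hM k)
  refine ⟨(InnerProductSpace.toDual ℝ H).symm (WeakDual.toStrongDual φ), fun v => ?_⟩
  have h : Tendsto f U (𝓝 φ) := hφ
  rw [tendsto_iff_forall_eval_tendsto_topDualPairing] at h
  rw [InnerProductSpace.toDual_symm_apply]
  exact h v

theorem weakTendstoAlong_iff_ultrafilter {x : ι → H} {a : H} : WeakTendstoAlong l x a ↔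
    ∀ U : Ultrafilter ι, (U : Filter ι) ≤ l → WeakTendstoAlong (U : Filter ι) x a := by
  refine ⟨fun h U hU v => (h v).mono_left hU, fun h v => ?_⟩
  exact (tendsto_iff_ultrafilter _ _ _).2 fun U hU => h U hU v

/-- Opial's lemma: if the distances of `x k` to the points of `S` converge and all weak cluster
points, here limits along ultrafilters, lie in `S`, then `x` converges weakly to a point of `S`.
For cluster points `p` and `q`, convergence of `‖x k - p‖² - ‖x k - q‖²` forces
`⟪p, p - q⟫ = ⟪q, p - q⟫`. -/
theorem opial [CompleteSpace H] [l.NeBot] {x : ι → H} {M : ℝ} (hM : ∀ k, ‖x k‖ ≤ M) {S : Set H}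
    (hS : ∀ p ∈ S, ∃ r, Tendsto (fun k => ‖x k - p‖ ^ 2) l (𝓝 r))
    (hcl : ∀ (U : Ultrafilter ι) (a : H), (U : Filter ι) ≤ l →
      WeakTendstoAlong (U : Filter ι) x a → a ∈ S) :
    ∃ a ∈ S, WeakTendstoAlong l x a := by
  obtain ⟨p, hp⟩ := exists_weakTendstoAlong (Ultrafilter.of l) hM
  have hpS := hcl _ _ (Ultrafilter.of_le l) hp
  refine ⟨p, hpS, weakTendstoAlong_iff_ultrafilter.2 fun U hU => ?_⟩
  obtain ⟨q, hq⟩ := exists_weakTendstoAlong U hM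
  obtain ⟨r, hr⟩ := hS p hpS
  obtain ⟨s, hs⟩ := hS q (hcl _ _ hU hq)
  have hlim : Tendsto (fun k => inner ℝ (x k) (p - q)) l
      (𝓝 ((s - r + (‖p‖ ^ 2 - ‖q‖ ^ 2)) / 2)) := by
    refine (((hs.sub hr).add_const _).div_const 2).congr fun k => ?_
    rw [norm_sub_sq_real, norm_sub_sq_real, inner_sub_right]
    ring
  have h1 := tendsto_nhds_unique (hp (p - q)) (hlim.mono_left (Ultrafilter.of_le l))
  have h2 := tendsto_nhds_unique (hq (p - q)) (hlim.mono_left hU)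
  have h3 : inner ℝ (p - q) (p - q) = (0 : ℝ) := by
    rw [inner_sub_left, h1, h2, sub_self]
  rwa [sub_eq_zero.1 (inner_self_eq_zero.1 h3)]

/-- Joint closedness of two maximally monotone operators: weak limits of both variables are
allowed if the first components become close and the sums of the second components converge
strongly. In the limit `⟪x - p, u - q⟫ + ⟪x - r, v - s⟫ ≥ 0` for `(p, q) ∈ gra A` and
`(r, s) ∈ gra B`; were `(x, v) ∉ gra B`, some `(r, s)` would make the second term negative, hence
`(x, u) ∈ gra A`, and `(p, q) = (x, u)` yields a contradiction. -/
theorem mem_and_mem_of_weakTendstoAlong [l.NeBot] {A B : H → Set H}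
    (hA : IsMaximallyMonotone A) (hB : IsMaximallyMonotone B)
    {a b ua ub : ι → H} {x u v : H} {M N : ℝ}
    (hua : ∀ k, ua k ∈ A (a k)) (hub : ∀ k, ub k ∈ B (b k))
    (hax : WeakTendstoAlong l a x) (hbx : WeakTendstoAlong l b x)
    (hu : WeakTendstoAlong l ua u) (hv : WeakTendstoAlong l ub v)
    (hab : Tendsto (fun k => a k - b k) l (𝓝 0))
    (huv : Tendsto (fun k => ua k + ub k) l (𝓝 (u + v)))
    (hbM : ∀ k, ‖b k‖ ≤ M) (huN : ∀ k, ‖ua k‖ ≤ N) : u ∈ A x ∧ v ∈ B x := by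
  have key : ∀ p q r s, q ∈ A p → s ∈ B r →
      0 ≤ inner ℝ (x - p) (u - q) + inner ℝ (x - r) (v - s) := by
    intro p q r s hq hs
    have hlim := ((((tendsto_inner_zero_of_bounded hab huN).add
      (hbx.tendsto_inner hbM huv)).sub ((hax q).add (hu p))).sub ((hbx s).add (hv r))).add_const
      (inner ℝ p q + inner ℝ r s)
    have hnn : ∀ k, 0 ≤ inner ℝ (a k - b k) (ua k) + inner ℝ (b k) (ua k + ub k)
        - (inner ℝ (a k) q + inner ℝ (ua k) p) - (inner ℝ (b k) s + inner ℝ (ub k) r)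
        + (inner ℝ p q + inner ℝ r s) := by
      intro k
      have h1 := hA.1 _ _ _ _ (hua k) hq
      have h2 := hB.1 _ _ _ _ (hub k) hs
      simp only [inner_sub_left, inner_sub_right, inner_add_right] at h1 h2 ⊢
      rw [real_inner_comm p, real_inner_comm r]
      linarith
    have h := ge_of_tendsto' hlim hnn
    simp only [inner_sub_left, inner_sub_right, inner_add_right] at h ⊢
    rw [real_inner_comm p, real_inner_comm r] at h
    linarith
  have hvB : v ∈ B x := by
    by_contra hv'
    have : ¬ ∀ r s, s ∈ B r → 0 ≤ inner ℝ (x - r) (v - s) := fun h => hv' (hB.mem h)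
    push Not at this
    obtain ⟨r, s, hs, hlt⟩ := this
    have huA : u ∈ A x := hA.mem fun p q hq => by linarith [key p q r s hq hs]
    have := key x u r s huA hs
    simp only [sub_self, inner_zero_left] at this
    linarith
  refine ⟨hA.mem fun p q hq => ?_, hvB⟩
  simpa using key p q x v hq hvB

end Weak

/-! ### A recursive inequality with inertia -/

/-- Inertial analogue of the convergence of almost decreasing sequences: the positive parts of the
increments of `h` satisfy `θ (k + 1) ≤ a θ k + δ k` with `a < 1`, so they are summable. -/
theorem inertial_recursion {h α δ e : ℕ → ℝ} {a : ℝ} (h0 : ∀ k, 0 ≤ h k) (ha : a < 1)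
    (hα : ∀ k, 0 ≤ α k ∧ α k ≤ a) (hδ0 : ∀ k, 0 ≤ δ k) (hδ : Summable δ) (he : ∀ k, 0 ≤ e k)
    (hrec : ∀ k, h (k + 2) ≤ h (k + 1) + α k * (h (k + 1) - h k) + δ k - e k) :
    (∃ r, Tendsto h atTop (𝓝 r)) ∧ Summable e := by
  set θ : ℕ → ℝ := fun k => max (h (k + 1) - h k) 0 with hθ
  have hθ0 : ∀ k, 0 ≤ θ k := fun k => le_max_right _ _
  have ha0 : 0 ≤ a := (hα 0).1.trans (hα 0).2
  have hαθ : ∀ k, α k * (h (k + 1) - h k) ≤ a * θ k := fun k =>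
    (mul_le_mul_of_nonneg_left (le_max_left _ _) (hα k).1).trans
      (mul_le_mul_of_nonneg_right (hα k).2 (hθ0 k))
  have hstep : ∀ k, θ (k + 1) ≤ a * θ k + δ k := fun k => by
    refine max_le ?_ (add_nonneg (mul_nonneg ha0 (hθ0 k)) (hδ0 k))
    linarith [hrec k, hαθ k, he k]
  have hδs : ∀ n, ∑ k ∈ Finset.range n, δ k ≤ ∑' k, δ k :=
    fun n => hδ.sum_le_tsum _ fun k _ => hδ0 k
  have hθsum : Summable θ := by
    refine summable_of_sum_range_le (c := (θ 0 + ∑' k, δ k) / (1 - a)) hθ0 fun n => ?_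
    rw [le_div_iff₀ (by linarith)]
    have h1 : ∑ k ∈ Finset.range (n + 1), θ k ≤
        a * ∑ k ∈ Finset.range n, θ k + ∑ k ∈ Finset.range n, δ k + θ 0 := by
      rw [Finset.sum_range_succ', Finset.mul_sum, ← Finset.sum_add_distrib]
      gcongr
      exact hstep _
    rw [Finset.sum_range_succ] at h1
    linarith [hδs n, hθ0 n]
  have hθs : ∀ n, ∑ k ∈ Finset.range n, θ k ≤ ∑' k, θ k :=
    fun n => hθsum.sum_le_tsum _ fun k _ => hθ0 k
  constructor
  · have hanti : Antitone fun n => h n - ∑ k ∈ Finset.range n, θ k := by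
      refine antitone_nat_of_succ_le fun n => ?_
      rw [Finset.sum_range_succ]
      linarith [le_max_left (h (n + 1) - h n) 0]
    have hlim := tendsto_atTop_ciInf hanti
      ⟨-∑' k, θ k, by rintro _ ⟨n, rfl⟩; simp only; linarith [hθs n, h0 n]⟩
    exact ⟨_, (hlim.add hθsum.hasSum.tendsto_sum_nat).congr fun n => by ring⟩
  · refine summable_of_sum_range_le (c := h 1 + a * ∑' k, θ k + ∑' k, δ k) he fun n => ?_
    have h1 : ∑ k ∈ Finset.range n, e k ≤
        ∑ k ∈ Finset.range n, (a * θ k + δ k - (h (k + 1 + 1) - h (k + 1))) :=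
      Finset.sum_le_sum fun k _ => by linarith [hrec k, hαθ k]
    rw [Finset.sum_sub_distrib, Finset.sum_range_sub (fun k => h (k + 1)), Finset.sum_add_distrib,
      ← Finset.mul_sum] at h1
    linarith [h0 (n + 1), hδs n, mul_le_mul_of_nonneg_left (hθs n) ha0]

/-! ### The splitting step -/

section Step

variable {H : Type*} [NormedAddCommGroup H] [InnerProductSpace ℝ H]

/-- The Fejér estimate behind the algorithm, in coordinates centred at a fixed point: `Y` stands
for `y - p`, `b` for `x_B - x`, `a` for `x_A - x` and `c` for `C x_B - C x`. The last two inner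
products are the monotonicity terms of `B` and `A`. -/
theorem norm_sq_add_smul_le {Y a b c : H} {β γ t : ℝ} (hγ : 0 ≤ γ) (ht0 : 0 ≤ t) (ht1 : t ≤ 1)
    (hc : β * ‖c‖ ^ 2 ≤ inner ℝ b c) :
    ‖Y + t • (a - b)‖ ^ 2 ≤ ‖Y‖ ^ 2 - t * (‖a - b + γ • c‖ ^ 2 + γ * (2 * β - γ) * ‖c‖ ^ 2 +
      2 * inner ℝ b (Y - b) + 2 * inner ℝ a ((2 : ℝ) • b - Y - γ • c - a)) := by
  obtain ⟨d, rfl⟩ : ∃ d, a = b + d := ⟨a - b, by abel⟩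
  rw [add_sub_cancel_left]
  have h1 : ‖Y + t • d‖ ^ 2 = ‖Y‖ ^ 2 + 2 * t * inner ℝ Y d + t ^ 2 * ‖d‖ ^ 2 := by
    rw [norm_add_sq_real, norm_smul, mul_pow, Real.norm_eq_abs, sq_abs, real_inner_smul_right]
    ring
  have h2 : ‖d + γ • c‖ ^ 2 = ‖d‖ ^ 2 + 2 * γ * inner ℝ d c + γ ^ 2 * ‖c‖ ^ 2 := by
    rw [norm_add_sq_real, norm_smul, mul_pow, Real.norm_eq_abs, sq_abs, real_inner_smul_right]
    ring
  have h3 : inner ℝ b (Y - b) + inner ℝ (b + d) ((2 : ℝ) • b - Y - γ • c - (b + d)) =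
      -inner ℝ Y d - ‖d‖ ^ 2 - γ * inner ℝ b c - γ * inner ℝ d c := by
    simp only [inner_add_left, inner_sub_right, inner_add_right, real_inner_smul_right,
      real_inner_self_eq_norm_sq]
    rw [real_inner_comm d b, real_inner_comm d Y]
    ring
  rw [h1, h2]
  have h4 : 0 ≤ t * γ * (inner ℝ b c - β * ‖c‖ ^ 2) :=
    mul_nonneg (mul_nonneg ht0 hγ) (sub_nonneg.2 hc)
  have h5 : 0 ≤ t * (1 - t) * ‖d‖ ^ 2 :=
    mul_nonneg (mul_nonneg ht0 (sub_nonneg.2 ht1)) (sq_nonneg _)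
  have h6 := congrArg (fun r => 2 * t * r) h3
  linarith

theorem norm_extrapolation_sq (x w p : H) (t : ℝ) : ‖x + t • (x - w) - p‖ ^ 2 =
    (1 + t) * ‖x - p‖ ^ 2 - t * ‖w - p‖ ^ 2 + t * (1 + t) * ‖x - w‖ ^ 2 := by
  obtain ⟨X, rfl⟩ : ∃ X, x = p + X := ⟨x - p, by abel⟩
  obtain ⟨W, rfl⟩ : ∃ W, w = p + W := ⟨w - p, by abel⟩
  rw [show p + X + t • (p + X - (p + W)) - p = X + t • (X - W) by module,
    show p + X - (p + W) = X - W by abel, add_sub_cancel_left, add_sub_cancel_left,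
    norm_add_sq_real, norm_smul, mul_pow, Real.norm_eq_abs, sq_abs, real_inner_smul_right,
    inner_sub_right, real_inner_self_eq_norm_sq, norm_sub_sq_real]
  ring

variable {A B : H → Set H} {C : H → H} {γ : ℝ}

theorem isFixedPt_splittingMap_iff {p : H} : Function.IsFixedPt (splittingMap γ A B C) p ↔
    resolventMap γ A ((2 : ℝ) • resolventMap γ B p - p - γ • C (resolventMap γ B p)) =
      resolventMap γ B p := by
  rw [Function.IsFixedPt, splittingMap, sub_add_eq_add_sub, add_sub_assoc, add_eq_left, sub_eq_zero]

variable [CompleteSpace H]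

/-- A pair of elements of `B x` and `A x` which sum to `-C x` produces a fixed point. -/
theorem isFixedPt_of_mem (hA : IsMaximallyMonotone A) (hB : IsMaximallyMonotone B) (hγ : 0 < γ)
    {p x : H} (hb : γ⁻¹ • (p - x) ∈ B x) (ha : γ⁻¹ • (x - p) - C x ∈ A x) :
    Function.IsFixedPt (splittingMap γ A B C) p ∧ resolventMap γ B p = x := by
  have hx := hB.resolvent_eq hγ hb
  refine ⟨isFixedPt_splittingMap_iff.2 ?_, hx⟩
  rw [hx]
  refine hA.resolvent_eq hγ ?_
  convert ha using 1
  nth_rw 2 [← inv_smul_smul₀ hγ.ne' (C x)]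
  module

theorem exists_isFixedPt (hA : IsMaximallyMonotone A) (hB : IsMaximallyMonotone B) (hγ : 0 < γ)
    (h : (zer (A + B + single C)).Nonempty) :
    ∃ p, Function.IsFixedPt (splittingMap γ A B C) p := by
  obtain ⟨x, hx⟩ := h
  obtain ⟨_, ⟨a, ha, b, hb, rfl⟩, c, hc, hsum⟩ := hx
  obtain rfl : c = C x := hc
  refine ⟨x + γ • b, (isFixedPt_of_mem hA hB hγ (x := x) ?_ ?_).1⟩
  · rwa [add_sub_cancel_left, inv_smul_smul₀ hγ.ne']
  · rw [sub_add_cancel_left, smul_neg, inv_smul_smul₀ hγ.ne']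
    have : a + b + C x = 0 := hsum
    rwa [show -b - C x = a by rw [← sub_eq_zero, ← neg_eq_zero, ← this]; abel]

theorem mem_of_isFixedPt (hA : IsMaximallyMonotone A) (hγ : 0 < γ)
    {p : H} (hp : Function.IsFixedPt (splittingMap γ A B C) p) :
    γ⁻¹ • ((2 : ℝ) • resolventMap γ B p - p - γ • C (resolventMap γ B p) - resolventMap γ B p) ∈
      A (resolventMap γ B p) := by
  have h := hA.resolvent_mem hγ
    ((2 : ℝ) • resolventMap γ B p - p - γ • C (resolventMap γ B p))
  rwa [isFixedPt_splittingMap_iff.1 hp] at h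

theorem resolvent_mem_zer (hA : IsMaximallyMonotone A) (hB : IsMaximallyMonotone B) (hγ : 0 < γ)
    {p : H} (hp : Function.IsFixedPt (splittingMap γ A B C) p) :
    resolventMap γ B p ∈ zer (A + B + single C) := by
  refine ⟨_, ⟨_, mem_of_isFixedPt hA hγ hp, _, hB.resolvent_mem hγ p, rfl⟩, _, rfl, ?_⟩
  generalize resolventMap γ B p = x
  change γ⁻¹ • ((2 : ℝ) • x - p - γ • C x - x) + γ⁻¹ • (p - x) + C x = 0
  have h : γ⁻¹ • ((2 : ℝ) • x - p - γ • C x - x) + γ⁻¹ • (p - x) + C x =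
      C x - γ⁻¹ • γ • C x := by module
  rw [h, inv_smul_smul₀ hγ.ne', sub_self]

theorem norm_resolventMap_sub_le (hB : IsMaximallyMonotone B) (hγ : 0 < γ) (y p : H) :
    ‖resolventMap γ B y - resolventMap γ B p‖ ≤ ‖y - p‖ := by
  have h := hB.1.inner_resolvent_nonneg hγ (hB.resolvent_mem hγ y) (hB.resolvent_mem hγ p)
  rw [sub_sub_sub_comm, inner_sub_right, real_inner_self_eq_norm_sq] at h
  have h2 := real_inner_le_norm (resolventMap γ B y - resolventMap γ B p) (y - p)
  by_contra! hlt
  nlinarith [norm_nonneg (y - p)]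

end Step

/-! ### The strong convergence criterion -/

section Strong

variable {H : Type*} [NormedAddCommGroup H] [InnerProductSpace ℝ H]

/-- Uniform monotonicity on bounded sets turns vanishing monotonicity terms into strong
convergence. -/
theorem IsUniformlyMonotoneOnBounded.tendsto {A : H → Set H}
    (hA : IsUniformlyMonotoneOnBounded A) {xs us : ℕ → H} {x u : H} {M : ℝ}
    (hxs : ∀ k, us k ∈ A (xs k)) (hx : u ∈ A x) (hM : ∀ k, ‖xs k‖ ≤ M)
    (hlim : Tendsto (fun k => inner ℝ (xs k - x) (us k - u)) atTop (𝓝 0)) :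
    Tendsto xs atTop (𝓝 x) := by
  obtain ⟨φ, hmono, hφ0, hφ⟩ := hA (insert x (Set.range xs))
    (by
      rintro _ (rfl | ⟨k, rfl⟩)
      exacts [⟨u, hx⟩, ⟨us k, hxs k⟩])
    (Set.insert_nonempty _ _)
    ((isBounded_iff_forall_norm_le.2 ⟨M, by rintro _ ⟨k, rfl⟩; exact hM k⟩).insert x)
  have hle : ∀ k, φ ‖xs k - x‖₊ ≤ ENNReal.ofReal (inner ℝ (xs k - x) (us k - u)) := by
    intro k
    have h := hφ (xs k) (Or.inr ⟨k, rfl⟩) x (Or.inl rfl) (us k) u (hxs k) hx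
    rw [← EReal.coe_ennreal_le_coe_ennreal_iff, EReal.coe_ennreal_ofReal]
    exact h.trans (EReal.coe_le_coe_iff.2 (le_max_left _ _))
  have hlim' : Tendsto (fun k => ENNReal.ofReal (inner ℝ (xs k - x) (us k - u))) atTop (𝓝 0) := by
    simpa using ENNReal.tendsto_ofReal hlim
  rw [Metric.tendsto_nhds]
  intro ε hε
  have hpos : 0 < φ ε.toNNReal := by
    rw [pos_iff_ne_zero, Ne, hφ0]
    simpa using hε
  filter_upwards [hlim'.eventually_lt_const hpos] with k hk
  have hlt := (hle k).trans_lt hk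
  by_contra! hge
  refine hlt.not_ge (hmono ?_)
  rw [Real.toNNReal_le_iff_le_coe, coe_nnnorm, ← dist_eq_norm]
  exact hge

end Strong

/-! ### Convergence of the inertial iteration -/

section Iteration

theorem exists_norm_le_of_tendsto {E : Type*} [NormedAddCommGroup E] {x w : ℕ → E} {a : E}
    {M : ℝ} (h : Tendsto (fun k => x k - w k) atTop (𝓝 a)) (hw : ∀ k, ‖w k‖ ≤ M) :
    ∃ N, ∀ k, ‖x k‖ ≤ N := by
  obtain ⟨N, hN⟩ := h.norm.bddAbove_range
  refine ⟨N + M, fun k => ?_⟩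
  calc ‖x k‖ = ‖(x k - w k) + w k‖ := by rw [sub_add_cancel]
    _ ≤ N + M := (norm_add_le _ _).trans (add_le_add (hN ⟨k, rfl⟩) (hw k))

variable {H : Type*} [NormedAddCommGroup H] [InnerProductSpace ℝ H] [CompleteSpace H]
  {A B : H → Set H} {C : H → H} {β γ : ℝ}
  {α lam : ℕ → ℝ} {z : ℤ → H} {y xA xB : ℕ → H}

theorem IsInertialSplitting.mem_B (halg : IsInertialSplitting γ A B C α lam z y xA xB)
    (hB : IsMaximallyMonotone B) (hγ : 0 < γ) (k : ℕ) : γ⁻¹ • (y k - xB k) ∈ B (xB k) := by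
  rw [halg.xB_eq]
  exact hB.resolvent_mem hγ _

theorem IsInertialSplitting.mem_A (halg : IsInertialSplitting γ A B C α lam z y xA xB)
    (hA : IsMaximallyMonotone A) (hγ : 0 < γ) (k : ℕ) :
    γ⁻¹ • ((2 : ℝ) • xB k - y k - γ • C (xB k) - xA k) ∈ A (xA k) := by
  rw [halg.xA_eq k]
  exact hA.resolvent_mem hγ _

/-- Quasi-Fejér behaviour with respect to a fixed point `p` with `x = J_{γB} p`: the distances
to `p` converge and all terms discarded in the descent estimate tend to zero. -/
theorem IsInertialSplitting.fejer (halg : IsInertialSplitting γ A B C α lam z y xA xB)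
    (hA : IsMaximallyMonotone A) (hB : IsMaximallyMonotone B)
    (hC : IsCocoercive β C) (hγ : 0 < γ) (hγβ : γ < 2 * β)
    {αbar lamlow : ℝ} (hαbar : αbar < 1) (hα : ∀ k, 0 ≤ α k ∧ α k ≤ αbar)
    (hlamlow : 0 < lamlow) (hlam : ∀ k, lamlow ≤ lam k ∧ lam k < 1)
    (hsum : Summable fun k : ℕ => α k * ‖z k - z ((k : ℤ) - 1)‖ ^ 2)
    {p : H} (hp : Function.IsFixedPt (splittingMap γ A B C) p) {x : H}
    (hx : resolventMap γ B p = x) :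
    (∃ r, Tendsto (fun k : ℕ => ‖z k - p‖ ^ 2) atTop (𝓝 r)) ∧
    Tendsto (fun k => C (xB k)) atTop (𝓝 (C x)) ∧
    Tendsto (fun k => xA k - xB k) atTop (𝓝 0) ∧
    Tendsto (fun k => inner ℝ (xB k - x) (γ⁻¹ • (y k - xB k) - γ⁻¹ • (p - x))) atTop (𝓝 0) ∧
    Tendsto (fun k => inner ℝ (xA k - x) (γ⁻¹ • ((2 : ℝ) • xB k - y k - γ • C (xB k) - xA k) -
      γ⁻¹ • ((2 : ℝ) • x - p - γ • C x - x))) atTop (𝓝 0) := by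
  have hxB : γ⁻¹ • (p - x) ∈ B x := hx ▸ hB.resolvent_mem hγ p
  have hxA : γ⁻¹ • ((2 : ℝ) • x - p - γ • C x - x) ∈ A x := hx ▸ mem_of_isFixedPt hA hγ hp
  have hcpos : 0 < γ * (2 * β - γ) := mul_pos hγ (by linarith)
  set d : ℕ → H := fun k => xA k - xB k + γ • (C (xB k) - C x) with hd
  set mB : ℕ → ℝ := fun k => inner ℝ (xB k - x) (y k - xB k - (p - x)) with hmB
  set mA : ℕ → ℝ := fun k => inner ℝ (xA k - x) ((2 : ℝ) • xB k - y k - γ • C (xB k) - xA k -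
      ((2 : ℝ) • x - p - γ • C x - x)) with hmA
  have hmB0 : ∀ k, 0 ≤ mB k := fun k =>
    hB.1.inner_resolvent_nonneg hγ (halg.mem_B hB hγ k) hxB
  have hmA0 : ∀ k, 0 ≤ mA k := fun k =>
    hA.1.inner_resolvent_nonneg hγ (halg.mem_A hA hγ k) hxA
  set e : ℕ → ℝ := fun k => ‖d k‖ ^ 2 + γ * (2 * β - γ) * ‖C (xB k) - C x‖ ^ 2 + 2 * mB k +
    2 * mA k with he
  have hc0 : ∀ k, 0 ≤ γ * (2 * β - γ) * ‖C (xB k) - C x‖ ^ 2 := fun k =>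
    mul_nonneg hcpos.le (sq_nonneg _)
  have he0 : ∀ k, 0 ≤ e k := fun k => by
    have := hmA0 k; have := hmB0 k; have := hc0 k; have := sq_nonneg ‖d k‖
    simp only [he]; linarith
  have hdesc : ∀ k : ℕ, ‖z ((k : ℤ) + 1) - p‖ ^ 2 ≤ ‖y k - p‖ ^ 2 - lam k * e k := by
    intro k
    have h := norm_sq_add_smul_le (Y := y k - p) (a := xA k - x) (b := xB k - x)
      (c := C (xB k) - C x) hγ.le (hlamlow.le.trans (hlam k).1) (hlam k).2.le (hC _ _)
    rw [sub_sub_sub_cancel_right] at h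
    rw [halg.z_eq, add_sub_right_comm]
    have h1 : y k - p - (xB k - x) = y k - xB k - (p - x) := sub_sub_sub_comm _ _ _ _
    have h2 : (2 : ℝ) • (xB k - x) - (y k - p) - γ • (C (xB k) - C x) - (xA k - x) =
        (2 : ℝ) • xB k - y k - γ • C (xB k) - xA k - ((2 : ℝ) • x - p - γ • C x - x) := by module
    rwa [h1, h2] at h
  have hrec : ∀ k : ℕ, ‖z (((k + 2 : ℕ) : ℤ) - 1) - p‖ ^ 2 ≤ ‖z (((k + 1 : ℕ) : ℤ) - 1) - p‖ ^ 2 +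
      α k * (‖z (((k + 1 : ℕ) : ℤ) - 1) - p‖ ^ 2 - ‖z ((k : ℤ) - 1) - p‖ ^ 2) +
      2 * (α k * ‖z k - z ((k : ℤ) - 1)‖ ^ 2) - lamlow * e k := by
    intro k
    rw [show ((k + 2 : ℕ) : ℤ) - 1 = (k : ℤ) + 1 by push_cast; ring,
      show ((k + 1 : ℕ) : ℤ) - 1 = (k : ℤ) by push_cast; ring]
    have h1 := hdesc k
    have h2 := mul_le_mul_of_nonneg_right (hlam k).1 (he0 k)
    rw [halg.y_eq, norm_extrapolation_sq] at h1
    have h3 : 0 ≤ (1 - α k) * (α k * ‖z k - z ((k : ℤ) - 1)‖ ^ 2) :=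
      mul_nonneg (by linarith [(hα k).2]) (mul_nonneg (hα k).1 (sq_nonneg _))
    linarith
  obtain ⟨⟨r, hr⟩, hes⟩ := inertial_recursion (h := fun k : ℕ => ‖z ((k : ℤ) - 1) - p‖ ^ 2)
    (δ := fun k : ℕ => 2 * (α k * ‖z k - z ((k : ℤ) - 1)‖ ^ 2)) (e := fun k => lamlow * e k)
    (fun k => sq_nonneg _) hαbar hα
    (fun k => mul_nonneg zero_le_two (mul_nonneg (hα k).1 (sq_nonneg _))) (hsum.mul_left 2)
    (fun k => mul_nonneg hlamlow.le (he0 k)) hrec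
  have he_lim : Tendsto e atTop (𝓝 0) :=
    ((summable_mul_left_iff hlamlow.ne').1 hes).tendsto_atTop_zero
  have hsq : ∀ {w : ℕ → H}, Tendsto (fun k => ‖w k‖ ^ 2) atTop (𝓝 0) → Tendsto w atTop (𝓝 0) := by
    intro w hw
    rw [tendsto_zero_iff_norm_tendsto_zero]
    simpa using hw.sqrt
  have hlim_of_le : ∀ {f : ℕ → ℝ} {s : ℝ}, (∀ k, 0 ≤ f k) → (∀ k, f k ≤ s * e k) →
      Tendsto f atTop (𝓝 0) := fun h0 hle =>
    squeeze_zero h0 hle (by simpa using he_lim.const_mul _)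
  have hclim : Tendsto (fun k => C (xB k) - C x) atTop (𝓝 0) := by
    refine hsq (hlim_of_le (s := (γ * (2 * β - γ))⁻¹) (fun k => sq_nonneg _) fun k => ?_)
    rw [inv_mul_eq_div, le_div_iff₀ hcpos, mul_comm]
    have := hmA0 k; have := hmB0 k; have := sq_nonneg ‖d k‖
    simp only [he]; linarith
  have hdlim : Tendsto d atTop (𝓝 0) := by
    refine hsq (hlim_of_le (s := 1) (fun k => sq_nonneg _) fun k => ?_)
    have := hmA0 k; have := hmB0 k; have := hc0 k
    simp only [he]; linarith
  refine ⟨⟨r, ?_⟩, tendsto_sub_nhds_zero_iff.1 hclim, ?_, ?_, ?_⟩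
  · refine (hr.comp (tendsto_add_atTop_nat 1)).congr fun k => ?_
    simp
  · have := hdlim.sub (hclim.const_smul γ)
    simpa [hd] using this
  · have : Tendsto mB atTop (𝓝 0) := hlim_of_le (s := 1) hmB0 fun k => by
      have := hmA0 k; have := hmB0 k; have := hc0 k; have := sq_nonneg ‖d k‖
      simp only [he]; linarith
    simpa only [← smul_sub, real_inner_smul_right, mul_zero] using this.const_mul γ⁻¹
  · have : Tendsto mA atTop (𝓝 0) := hlim_of_le (s := 1) hmA0 fun k => by
      have := hmA0 k; have := hmB0 k; have := hc0 k; have := sq_nonneg ‖d k‖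
      simp only [he]; linarith
    simpa only [← smul_sub, real_inner_smul_right, mul_zero] using this.const_mul γ⁻¹

/-- Identification of weak cluster points. Since `C x_B` converges strongly, the sum of the
selections of `A` and `B` does, so that the weak limits satisfy both inclusions. -/
theorem cluster_isFixedPt {l : Filter ℕ} [l.NeBot] (hA : IsMaximallyMonotone A)
    (hB : IsMaximallyMonotone B) (hβ : 0 < β) (hC : IsCocoercive β C) (hγ : 0 < γ)
    (hmA : ∀ k, γ⁻¹ • ((2 : ℝ) • xB k - y k - γ • C (xB k) - xA k) ∈ A (xA k))
    (hmB : ∀ k, γ⁻¹ • (y k - xB k) ∈ B (xB k)) {c w x : H} {M N : ℝ}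
    (hc : Tendsto (fun k => C (xB k)) l (𝓝 c))
    (hd : Tendsto (fun k => xA k - xB k) l (𝓝 0))
    (hy : WeakTendstoAlong l y w) (hx : WeakTendstoAlong l xB x) (hM : ∀ k, ‖xB k‖ ≤ M)
    (hN : ∀ k, ‖γ⁻¹ • ((2 : ℝ) • xB k - y k - γ • C (xB k) - xA k)‖ ≤ N) :
    Function.IsFixedPt (splittingMap γ A B C) w ∧ resolventMap γ B w = x := by
  have hxA : WeakTendstoAlong l xA x := by
    have := (weakTendstoAlong_of_tendsto hd).add hx
    simpa only [sub_add_cancel, zero_add] using this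
  -- cocoercivity makes `C` weak-to-strong closed
  have hCx : C x = c := by
    have h1 : Tendsto (fun k => inner ℝ (xB k - x) (C (xB k) - C x)) l
        (𝓝 (inner ℝ (0 : H) (c - C x))) := by
      refine WeakTendstoAlong.tendsto_inner (M := M + ‖x‖) ?_ (fun k => ?_) (hc.sub_const _)
      · simpa only [sub_self] using hx.sub (weakTendstoAlong_of_tendsto (tendsto_const_nhds (x := x)))
      · exact (norm_sub_le _ _).trans (by gcongr; exact hM k)
    have h2 := le_of_tendsto_of_tendsto' (((hc.sub_const (C x)).norm.pow 2).const_mul β) h1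
      fun k => hC (xB k) x
    rw [inner_zero_left] at h2
    have h3 : ‖c - C x‖ ^ 2 = 0 := le_antisymm (nonpos_of_mul_nonpos_right h2 hβ) (sq_nonneg _)
    have h4 := sub_eq_zero.1 (norm_eq_zero.1 (pow_eq_zero_iff two_ne_zero |>.1 h3))
    exact h4.symm
  have hcancel : ∀ v : H, γ⁻¹ • γ • v = v := fun v => inv_smul_smul₀ hγ.ne' v
  have hA' : γ⁻¹ • ((2 : ℝ) • x - w - γ • c - x) = γ⁻¹ • (x - w) - c := by
    nth_rw 2 [← hcancel c]
    module
  have h := mem_and_mem_of_weakTendstoAlong hA hB hmA hmB hxA hx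
    (((((hx.const_smul 2).sub hy).sub ((weakTendstoAlong_of_tendsto hc).const_smul γ)).sub
      hxA).const_smul γ⁻¹) ((hy.sub hx).const_smul γ⁻¹) hd
    (by
      have h1 := (hd.const_smul (-γ⁻¹)).sub hc
      rw [smul_zero, zero_sub] at h1
      refine (h1.congr fun k => ?_).trans_eq ?_
      · nth_rw 1 [← hcancel (C (xB k))]
        module
      · congr 1
        rw [hA']
        module) hM hN
  rw [hA', ← hCx] at h
  exact isFixedPt_of_mem hA hB hγ h.2 h.1

end Iteration

end MonotoneInclusion

theorem mainTheorem2 {H : Type*} [NormedAddCommGroup H] [InnerProductSpace ℝ H] [CompleteSpace H]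
    (A B : H → Set H) (C : H → H) (β γ : ℝ)
    (hA : IsMaximallyMonotone A) (hB : IsMaximallyMonotone B)
    (hβ : 0 < β) (hC : IsCocoercive β C)
    (hγ : 0 < γ) (hγβ : γ < 2 * β)
    (hzer : (zer (A + B + single C)).Nonempty)
    (αbar lamlow : ℝ) (α lam : ℕ → ℝ)
    (hαbar : αbar < 1) (hα : ∀ k, 0 ≤ α k ∧ α k ≤ αbar)
    (hlamlow : 0 < lamlow) (hlam : ∀ k, lamlow ≤ lam k ∧ lam k < 1)
    (z : ℤ → H) (y xA xB : ℕ → H)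
    (halg : IsInertialSplitting γ A B C α lam z y xA xB)
    (hsum : Summable fun k : ℕ => α k * ‖z k - z ((k : ℤ) - 1)‖ ^ 2) :
    ∃ zstar : H,
      Function.IsFixedPt (splittingMap γ A B C) zstar ∧
      WeakTendsto (fun k : ℕ => z k) zstar ∧
      resolventMap γ B zstar ∈ zer (A + B + single C) ∧
      WeakTendsto xB (resolventMap γ B zstar) ∧
      WeakTendsto xA (resolventMap γ B zstar) ∧
      ((IsUniformlyMonotoneOnBounded A ∨ IsUniformlyMonotoneOnBounded B ∨
          ∀ x ∈ zer (A + B + single C), IsDemiregularAt (single C) x) →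
        Tendsto xA atTop (𝓝 (resolventMap γ B zstar)) ∧
        Tendsto xB atTop (𝓝 (resolventMap γ B zstar))) := by
  obtain ⟨p, hp⟩ := exists_isFixedPt hA hB hγ hzer
  have hfej := fun {q : H} (hq : Function.IsFixedPt (splittingMap γ A B C) q) =>
    halg.fejer hA hB hC hγ hγβ hαbar hα hlamlow hlam hsum hq rfl
  obtain ⟨⟨r, hr⟩, hCp, hd, -, -⟩ := hfej hp
  obtain ⟨Mz, hMz⟩ : ∃ M, ∀ k : ℕ, ‖z k‖ ≤ M := by
    obtain ⟨R, hR⟩ := hr.bddAbove_range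
    refine ⟨√R + ‖p‖, fun k => ?_⟩
    have h1 : ‖z k - p‖ ≤ √R := Real.le_sqrt_of_sq_le (hR ⟨k, rfl⟩)
    linarith [norm_le_norm_sub_add (z k) p]
  have hyz : Tendsto (fun k : ℕ => y k - z k) atTop (𝓝 0) := by
    rw [tendsto_zero_iff_norm_tendsto_zero]
    have h0 : Tendsto (fun k : ℕ => ‖y k - z k‖ ^ 2) atTop (𝓝 0) := by
      refine squeeze_zero (fun k => sq_nonneg _) (fun k => ?_) hsum.tendsto_atTop_zero
      rw [halg.y_eq, add_sub_cancel_left, norm_smul, mul_pow, Real.norm_eq_abs, sq_abs]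
      refine mul_le_mul_of_nonneg_right ?_ (sq_nonneg _)
      nlinarith [(hα k).1, (hα k).2]
    simpa using h0.sqrt
  obtain ⟨My, hMy⟩ := exists_norm_le_of_tendsto hyz hMz
  have hMB : ∀ k, ‖xB k‖ ≤ My + ‖p‖ + ‖resolventMap γ B p‖ := fun k => by
    have h1 := norm_resolventMap_sub_le hB hγ (y k) p
    rw [← halg.xB_eq] at h1
    linarith [norm_le_norm_sub_add (xB k) (resolventMap γ B p), norm_sub_le (y k) p, hMy k]
  obtain ⟨MA, hMA⟩ := exists_norm_le_of_tendsto hd hMB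
  obtain ⟨MC, hMC⟩ := hCp.norm.bddAbove_range
  have hMu : ∀ k, ‖γ⁻¹ • ((2 : ℝ) • xB k - y k - γ • C (xB k) - xA k)‖ ≤
      γ⁻¹ * (2 * (My + ‖p‖ + ‖resolventMap γ B p‖) + My + γ * MC + MA) := fun k => by
    rw [norm_smul, Real.norm_of_nonneg (inv_pos.2 hγ).le]
    refine mul_le_mul_of_nonneg_left ?_ (inv_pos.2 hγ).le
    refine (norm_sub_le _ _).trans (add_le_add ((norm_sub_le _ _).trans (add_le_add
      ((norm_sub_le _ _).trans (add_le_add ?_ (hMy k))) ?_)) (hMA k))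
    · rw [norm_smul, Real.norm_two]
      linarith [hMB k]
    · rw [norm_smul, Real.norm_of_nonneg hγ.le]
      exact mul_le_mul_of_nonneg_left (hMC ⟨k, rfl⟩) hγ.le
  have hcluster : ∀ (U : Ultrafilter ℕ) (w : H), (U : Filter ℕ) ≤ atTop →
      WeakTendstoAlong (U : Filter ℕ) (fun k : ℕ => z k) w →
      Function.IsFixedPt (splittingMap γ A B C) w ∧
        WeakTendstoAlong (U : Filter ℕ) xB (resolventMap γ B w) := by
    intro U w hU hw
    have hy : WeakTendstoAlong (U : Filter ℕ) y w := by
      have := (weakTendstoAlong_of_tendsto (hyz.mono_left hU)).add hw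
      simpa only [sub_add_cancel, zero_add] using this
    obtain ⟨x, hx⟩ := exists_weakTendstoAlong U hMB
    obtain ⟨h1, rfl⟩ := cluster_isFixedPt hA hB hβ hC hγ (halg.mem_A hA hγ) (halg.mem_B hB hγ)
      (hCp.mono_left hU) (hd.mono_left hU) hy hx hMB hMu
    exact ⟨h1, hx⟩
  obtain ⟨s, hs, hzs⟩ := opial hMz (S := {q | Function.IsFixedPt (splittingMap γ A B C) q})
    (fun q hq => (hfej hq).1) fun U a hU ha => (hcluster U a hU ha).1
  have hxB : WeakTendstoAlong atTop xB (resolventMap γ B s) :=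
    weakTendstoAlong_iff_ultrafilter.2 fun U hU =>
      (hcluster U s hU (weakTendstoAlong_iff_ultrafilter.1 hzs U hU)).2
  have hxA : WeakTendstoAlong atTop xA (resolventMap γ B s) := by
    have := (weakTendstoAlong_of_tendsto hd).add hxB
    simpa only [sub_add_cancel, zero_add] using this
  obtain ⟨-, hCs, -, hmB, hmA⟩ := hfej hs
  have hszer := resolvent_mem_zer hA hB hγ hs
  refine ⟨s, hs, weakTendsto_iff.2 hzs, hszer, weakTendsto_iff.2 hxB, weakTendsto_iff.2 hxA, ?_⟩
  have hBA : Tendsto xB atTop (𝓝 (resolventMap γ B s)) →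
      Tendsto xA atTop (𝓝 (resolventMap γ B s)) := fun h => by
    simpa using hd.add h
  rintro (hU | hU | hdem)
  · have h := hU.tendsto (halg.mem_A hA hγ) (mem_of_isFixedPt hA hγ hs) hMA hmA
    exact ⟨h, by simpa using h.sub hd⟩
  · have h := hU.tendsto (halg.mem_B hB hγ) (hB.resolvent_mem hγ s) hMB hmB
    exact ⟨hBA h, h⟩
  · have h := (hdem _ hszer).2 _ rfl xB (fun k => C (xB k)) (fun k => rfl)
      (weakTendsto_iff.2 hxB) hCs
    exact ⟨hBA h, h⟩
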